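/- Let $\Lambda$ be a finite $k$-graph with no sources or sinks: $\Lambda$ is a countable category with a degree functor $d:\Lambda\to\mathbb{N}^k$ having the unique factorisation property, each $\Lambda^n:=d^{-1}(n)$ is finite, and for every vertex $v\in\Lambda^0$ and every $n\in\mathbb{N}^k$ there are paths of degree $n$ with range $v$ and paths of degree $n$ with source $v$. For $1\le i\le k$ let $A_i$ be the vertex matrix with entries $A_i(v,w)=|v\Lambda^{e_i}w|$, the number of paths of degree $e_i$ with range $v$ and source $w$; for $C\subset\Lambda^0$ let $A_{C,i}$ be its $C\times C$ block, and let $\rho$ denote the spectral radius. Let $r\in(0,\infty)^k$ satisfy \[\max\{r_i^{-1}\ln\rho(A_i):1\le i\le k\}=1.\] Let $\mathcal{T}C^*(\Lambda)$ be the Toeplitz algebra of $\Lambda$, generated by a universal Toeplitz--Cuntz--Krieger family $\{t_\lambda:\lambda\in\Lambda\}$ with vertex projections $q_v=t_v$, and let $\alpha^r$ be the action of $\mathbb{R}$ on it determined by $\alpha^r_t(t_\lambda)=e^{it\,r\cdot d(\lambda)}t_\lambda$. A strongly connected component of $\Lambda$ is an equivalence class of the relation $v\sim w\iff v\Lambda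 w\neq\emptyset\neq w\Lambda v$ on $\Lambda^0$; it is trivial if it is of the form $\{v\}$ with $v\Lambda v=\{v\}$. Fix $j\in\{1,\dots,k\}$ and let $C$ be a $j$-critical component, that is, a nontrivial strongly connected component such that $r_j^{-1}\ln\rho(A_j)=1$, $r_j=\ln\rho(A_{C,j})$ and $A_{C,j}$ is irreducible. Set \[\Sigma_jC:=\{w\in\Lambda^0: v\Lambda^{ne_j}w\neq\emptyset\text{ for some }v\in C,\ n\in\mathbb{N}\}.\] Then every KMS$_1$ state $\psi$ of $(\mathcal{T}C^*(\Lambda),\alpha^r)$ satisfies $\psi(q_w)=0$ for all $w\in(\Sigma_jC)\setminus C$. -/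

import Mathlib

open CategoryTheory
open scoped ENNReal ComplexOrder

universe w v u

/-! ## Higher-rank graphs -/

/-- The morphisms of a category, viewed as the paths of a `k`-graph. -/
structure GPath (V : Type u) [Category.{v} V] where
  source : V
  range : V
  hom : source ⟶ range

/-- A higher-rank graph of rank `k`: a countable category `V` together with a degree functor to
`ℕ^k` which has the unique factorisation property. In the usual notation the composite `g ≫ f`
is the path `f g`, so that `range (f g) = range f` and `source (f g) = source g`. The objects are
the vertices, a vertex being identified with its identity morphism. -/
structure KGraph (k : ℕ) (V : Type u) [Category.{v} V] where
  countable : Countable (GPath V)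
  degree : ∀ {x y : V}, (x ⟶ y) → (Fin k → ℕ)
  degree_id : ∀ x : V, degree (𝟙 x) = 0
  degree_comp : ∀ {x y z : V} (g : x ⟶ y) (f : y ⟶ z), degree (g ≫ f) = degree f + degree g
  factorisation : ∀ {x z : V} (h : x ⟶ z) (m n : Fin k → ℕ), degree h = m + n →
    ∃! p : (y : V) × (x ⟶ y) × (y ⟶ z),
      degree p.2.2 = m ∧ degree p.2.1 = n ∧ p.2.1 ≫ p.2.2 = h

/-- `IsComp l m n` says that `source l = range m` and that `n` is the composite path `l m`. -/
inductive IsComp {V : Type u} [Category.{v} V] : GPath V → GPath V → GPath V → Prop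
  | mk {x y z : V} (g : x ⟶ y) (f : y ⟶ z) : IsComp ⟨y, z, f⟩ ⟨x, y, g⟩ ⟨x, z, g ≫ f⟩

/-- The vertex `x`, regarded as a path of degree `0`. -/
def vertexPath {V : Type u} [Category.{v} V] (x : V) : GPath V := ⟨x, x, 𝟙 x⟩

namespace KGraph

variable {k : ℕ} {V : Type u} [Category.{v} V] (Λ : KGraph k V)

/-- The degree of a path. -/
def deg (l : GPath V) : Fin k → ℕ := Λ.degree l.hom

/-- The set of paths of degree `n` is finite for every `n`. -/
def IsFinite : Prop := ∀ n : Fin k → ℕ, {l : GPath V | Λ.deg l = n}.Finite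

/-- Each vertex receives and emits paths of every degree. -/
def NoSourcesOrSinks : Prop :=
  ∀ (x : V) (n : Fin k → ℕ),
    (∃ l : GPath V, l.range = x ∧ Λ.deg l = n) ∧ (∃ l : GPath V, l.source = x ∧ Λ.deg l = n)

/-- The vertex matrix of colour `i`: the `(x, y)` entry is the number of paths of degree `e_i`
with range `x` and source `y`. -/
noncomputable def vertexMatrix (i : Fin k) : Matrix V V ℕ :=
  fun x y => Nat.card {f : y ⟶ x // Λ.degree f = Pi.single i 1}

/-- The diagonal block of the vertex matrix of colour `i` that belongs to a set of vertices. -/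
noncomputable def blockMatrix (C : Set V) (i : Fin k) : Matrix C C ℕ :=
  (Λ.vertexMatrix i).submatrix Subtype.val Subtype.val

/-- The set of minimal common extensions: the pairs `(a, b)` of paths such that `l a = m b`, where
this path has degree `deg l ⊔ deg m`. -/
def minExt (l m : GPath V) : Set (GPath V × GPath V) :=
  {p | ∃ n, IsComp l p.1 n ∧ IsComp m p.2 n ∧ Λ.deg n = Λ.deg l ⊔ Λ.deg m}

lemma deg_of_isComp {l m n : GPath V} (h : IsComp l m n) : Λ.deg n = Λ.deg l + Λ.deg m := by
  cases h with
  | mk g f => exact Λ.degree_comp g f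

lemma minExt_finite (hΛ : Λ.IsFinite) (l m : GPath V) : (Λ.minExt l m).Finite := by
  refine ((hΛ (Λ.deg l ⊔ Λ.deg m - Λ.deg l)).prod (hΛ (Λ.deg l ⊔ Λ.deg m - Λ.deg m))).subset ?_
  rintro ⟨a, b⟩ ⟨n, h1, h2, h3⟩
  have e1 := Λ.deg_of_isComp h1
  have e2 := Λ.deg_of_isComp h2
  constructor
  · change Λ.deg a = _
    rw [← h3, e1, add_tsub_cancel_left]
  · change Λ.deg b = _
    rw [← h3, e2, add_tsub_cancel_left]

end KGraph

/-- The spectral radius (as a real number) of a finite square matrix with entries in `ℕ`. -/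
noncomputable def matrixSpectralRadius {n : Type*} [Finite n] (A : Matrix n n ℕ) : ℝ :=
  letI := Fintype.ofFinite n
  letI := Classical.decEq n
  (spectralRadius ℂ (A.map (Nat.cast : ℕ → ℂ))).toReal

namespace KGraph

variable {k : ℕ} {V : Type u} [Category.{v} V] (Λ : KGraph k V)

/-! ## Strongly connected components -/

/-- `C` is a strongly connected component: a class of the equivalence relation in which `x` and
`y` are equivalent when there are paths from `x` to `y` and from `y` to `x`. -/
def IsComponent (_Λ : KGraph k V) (C : Set V) : Prop :=
  ∃ x : V, C = {y | Nonempty (x ⟶ y) ∧ Nonempty (y ⟶ x)}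

/-- A trivial component is a single vertex with no path from it to itself apart from the vertex. -/
def IsTrivialComponent (_Λ : KGraph k V) (C : Set V) : Prop :=
  ∃ x : V, C = {x} ∧ ∀ f : x ⟶ x, f = 𝟙 x

/-- The nontrivial strongly connected components. -/
def IsNontrivialComponent (C : Set V) : Prop :=
  Λ.IsComponent C ∧ ¬ Λ.IsTrivialComponent C

/-- The normalisation `max_i r_i⁻¹ ln ρ(A_i) = 1` of the dynamics. -/
def IsNormalised [Finite V] (r : Fin k → ℝ) : Prop :=
  IsGreatest (Set.range fun i => (r i)⁻¹ * Real.log (matrixSpectralRadius (Λ.vertexMatrix i))) 1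

/-- `C` is a `j`-critical component for the vector `r`: it is a nontrivial strongly connected
component, the colour `j` attains `r_j⁻¹ ln ρ(A_j) = 1`, and the block `A_{C,j}` is irreducible
with `r_j = ln ρ(A_{C,j})`. -/
structure IsCritical [Finite V] (r : Fin k → ℝ) (j : Fin k) (C : Set V) : Prop where
  component : Λ.IsNontrivialComponent C
  colour : (r j)⁻¹ * Real.log (matrixSpectralRadius (Λ.vertexMatrix j)) = 1
  critical : r j = Real.log (matrixSpectralRadius (Λ.blockMatrix C j))
  irreducible : ((Λ.blockMatrix C j).map (Nat.cast : ℕ → ℝ)).IsIrreducible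

/-- The set of vertices that are the source of a path of degree in `ℕ e_j` with range in `C`. -/
def colourReach (j : Fin k) (C : Set V) : Set V :=
  {y | ∃ l : GPath V, l.range ∈ C ∧ l.source = y ∧ ∃ n : ℕ, Λ.deg l = n • Pi.single j 1}

/-! ## The Toeplitz algebra -/

/-- Toeplitz-Cuntz-Krieger families of partial isometries in a C*-algebra. -/
structure IsTCKFamily {B : Type*} [NonUnitalCStarAlgebra B] (T : GPath V → B) : Prop where
  partialIsometry : ∀ l, T l * star (T l) * T l = T l
  projection : ∀ x : V, IsStarProjection (T (vertexPath x))
  orthogonal : ∀ x y : V, x ≠ y → T (vertexPath x) * T (vertexPath y) = 0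
  comp_mul : ∀ l m n, IsComp l m n → T l * T m = T n
  adjoint_mul : ∀ l m, star (T l) * T m = ∑ᶠ p ∈ Λ.minExt l m, T p.1 * star (T p.2)

lemma IsTCKFamily.norm_le_one {Λ : KGraph k V} {B : Type*} [NonUnitalCStarAlgebra B]
    {T : GPath V → B} (h : Λ.IsTCKFamily T) (l : GPath V) : ‖T l‖ ≤ 1 := by
  have h1 : ‖star (T l) * T l‖ = ‖T l‖ * ‖T l‖ := CStarRing.norm_star_mul_self
  have h2 : (star (T l) * T l) * (star (T l) * T l) = star (T l) * T l := by
    rw [mul_assoc, ← mul_assoc (T l), h.partialIsometry]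
  have h3 : ‖star (star (T l) * T l) * (star (T l) * T l)‖ = _ := CStarRing.norm_star_mul_self
  rw [StarMul.star_mul, star_star, h2, h1] at h3
  rcases (norm_nonneg (T l)).eq_or_lt with h0 | h0
  · rw [← h0]; exact zero_le_one
  · have h4 : 0 < ‖T l‖ * ‖T l‖ := mul_pos h0 h0
    have h5 : ‖T l‖ * ‖T l‖ = 1 := by
      have := mul_right_cancel₀ h4.ne' ((one_mul _).trans h3)
      exact this.symm
    nlinarith

/-- For `z` in the torus and `n ∈ ℕ^k`, the number `z^n = ∏ z_i ^ n_i`. -/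
noncomputable def torusPow (z : Fin k → Circle) (n : Fin k → ℕ) : ℂ :=
  ∏ i, (z i : ℂ) ^ n i

lemma torusPow_add (z : Fin k → Circle) (m n : Fin k → ℕ) :
    torusPow z (m + n) = torusPow z m * torusPow z n := by
  simp [torusPow, pow_add, Finset.prod_mul_distrib]

lemma torusPow_star (z : Fin k → Circle) (n : Fin k → ℕ) :
    torusPow z n * star (torusPow z n) = 1 := by
  have : ‖torusPow z n‖ = 1 := by simp [torusPow, norm_prod, Circle.norm_coe]
  change torusPow z n * (starRingEnd ℂ) (torusPow z n) = 1
  rw [Complex.mul_conj, Complex.normSq_eq_norm_sq, this]; simp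

lemma torusPow_star' (z : Fin k → Circle) (n : Fin k → ℕ) :
    star (torusPow z n) * torusPow z n = 1 := by
  rw [mul_comm, torusPow_star]

/-- Multiplying a family by `z ^ deg` gives a family again. -/
lemma IsTCKFamily.gauge {Λ : KGraph k V} {B : Type*} [NonUnitalCStarAlgebra B]
    {T : GPath V → B} (h : Λ.IsTCKFamily T) (z : Fin k → Circle) :
    Λ.IsTCKFamily fun l => torusPow z (Λ.deg l) • T l := by
  have hv : ∀ x : V, torusPow z (Λ.deg (vertexPath x)) = 1 := fun x => by
    have : Λ.deg (vertexPath x) = 0 := Λ.degree_id x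
    simp [this, torusPow]
  refine ⟨fun l => ?_, fun x => ?_, fun x y hxy => ?_, fun l m n hn => ?_, fun l m => ?_⟩
  · simp only [star_smul, smul_mul_smul_comm, torusPow_star, one_mul, h.partialIsometry]
  · simpa only [hv, one_smul] using h.projection x
  · simpa only [hv, one_smul] using h.orthogonal x y hxy
  · simp only [smul_mul_smul_comm, h.comp_mul l m n hn, Λ.deg_of_isComp hn, torusPow_add]
  · simp only [star_smul, smul_mul_smul_comm, h.adjoint_mul l m]
    rw [smul_finsum]
    refine finsum_congr fun p => ?_
    rw [smul_finsum]
    refine finsum_congr fun hp => ?_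
    obtain ⟨n, h1, h2, -⟩ := hp
    congr 1
    have e : torusPow z (Λ.deg l) * torusPow z (Λ.deg p.1) =
        torusPow z (Λ.deg m) * torusPow z (Λ.deg p.2) := by
      rw [← torusPow_add, ← torusPow_add, ← Λ.deg_of_isComp h1, ← Λ.deg_of_isComp h2]
    calc star (torusPow z (Λ.deg l)) * torusPow z (Λ.deg m)
        = star (torusPow z (Λ.deg l)) * (torusPow z (Λ.deg m) * torusPow z (Λ.deg p.2)) *
          star (torusPow z (Λ.deg p.2)) := by
          rw [mul_assoc, mul_assoc, torusPow_star, mul_one]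
      _ = torusPow z (Λ.deg p.1) * star (torusPow z (Λ.deg p.2)) := by
          rw [← e, ← mul_assoc, torusPow_star', one_mul]

/-- A Toeplitz-Cuntz-Krieger family in some C*-algebra (of a given universe). -/
structure TCKRep where
  carrier : Type w
  [alg : NonUnitalCStarAlgebra carrier]
  T : GPath V → carrier
  isTCK : Λ.IsTCKFamily T

attribute [instance] TCKRep.alg

/-- The C*-algebra of bounded elements of the product of the C*-algebras of all families. -/
abbrev TCKProduct := lp (fun R : TCKRep.{w} Λ => R.carrier) ∞

/-- The direct sum of all Toeplitz-Cuntz-Krieger families. -/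
noncomputable def productFamily (l : GPath V) : TCKProduct.{w} Λ :=
  ⟨fun R => R.T l, memℓp_infty ⟨1, by rintro _ ⟨R, rfl⟩; exact R.isTCK.norm_le_one l⟩⟩

/-- The C*-algebra generated by the direct sum of all families. -/
noncomputable def toeplitzSubalgebra : NonUnitalStarSubalgebra ℂ (TCKProduct.{w} Λ) :=
  (NonUnitalStarAlgebra.adjoin ℂ (Set.range Λ.productFamily)).topologicalClosure

/-- The Toeplitz algebra of `Λ`: the C*-algebra generated by a universal
Toeplitz-Cuntz-Krieger family. It is realised inside the product over all families in
C*-algebras of the universe `w`, which may be any universe. -/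
def ToeplitzAlgebra : Type (max u v (w + 1)) := toeplitzSubalgebra.{w} Λ

noncomputable instance : NonUnitalCStarAlgebra (ToeplitzAlgebra.{w} Λ) :=
  NonUnitalStarSubalgebra.nonUnitalCStarAlgebra (toeplitzSubalgebra.{w} Λ)
    (h_closed := NonUnitalStarSubalgebra.isClosed_topologicalClosure _)

/-- The universal family `t`. -/
noncomputable def toeplitzFamily (l : GPath V) : ToeplitzAlgebra.{w} Λ :=
  ⟨Λ.productFamily l, NonUnitalStarSubalgebra.le_topologicalClosure _
    (NonUnitalStarAlgebra.subset_adjoin ℂ _ ⟨l, rfl⟩)⟩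

/-- The projections `q_x` of the universal family. -/
noncomputable def vertexProj (x : V) : ToeplitzAlgebra.{w} Λ := Λ.toeplitzFamily (vertexPath x)

/-- The inclusion of the Toeplitz algebra into the product, followed by a coordinate projection. -/
noncomputable def evalRep (R : TCKRep.{w} Λ) : ToeplitzAlgebra.{w} Λ →⋆ₙₐ[ℂ] R.carrier where
  toFun a := (a.1 : ∀ R : TCKRep.{w} Λ, R.carrier) R
  map_smul' _ _ := rfl
  map_zero' := rfl
  map_add' _ _ := rfl
  map_mul' _ _ := rfl
  map_star' _ := rfl

lemma toeplitz_ext {a b : ToeplitzAlgebra.{w} Λ} (h : ∀ R, Λ.evalRep R a = Λ.evalRep R b) :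
    a = b :=
  Subtype.ext (lp.ext (funext h))

/-- The universal family is a Toeplitz-Cuntz-Krieger family. -/
theorem toeplitzFamily_isTCK (hΛ : Λ.IsFinite) :
    Λ.IsTCKFamily (Λ.toeplitzFamily : GPath V → ToeplitzAlgebra.{w} Λ) := by
  have key : ∀ (R : TCKRep.{w} Λ) l, Λ.evalRep R (Λ.toeplitzFamily l) = R.T l := fun _ _ => rfl
  refine ⟨fun l => ?_, fun x => ⟨?_, ?_⟩, fun x y hxy => ?_, fun l m n hn => ?_, fun l m => ?_⟩
  · refine Λ.toeplitz_ext fun R => ?_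
    simp only [map_mul, map_star, key, R.isTCK.partialIsometry]
  · refine Λ.toeplitz_ext fun R => ?_
    simp only [map_mul, key]
    exact (R.isTCK.projection x).isIdempotentElem
  · refine Λ.toeplitz_ext fun R => ?_
    simp only [map_star, key]
    exact (R.isTCK.projection x).isSelfAdjoint
  · refine Λ.toeplitz_ext fun R => ?_
    simp only [map_mul, key, map_zero, R.isTCK.orthogonal x y hxy]
  · refine Λ.toeplitz_ext fun R => ?_
    simp only [map_mul, key, R.isTCK.comp_mul l m n hn]
  · refine Λ.toeplitz_ext fun R => ?_
    rw [finsum_mem_eq_finite_toFinset_sum _ (Λ.minExt_finite hΛ l m)]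
    simp only [map_mul, map_star, map_sum, key]
    rw [R.isTCK.adjoint_mul, finsum_mem_eq_finite_toFinset_sum _ (Λ.minExt_finite hΛ l m)]

/-- The universal family generates the Toeplitz algebra. -/
theorem toeplitz_generated (S : NonUnitalStarSubalgebra ℂ (ToeplitzAlgebra.{w} Λ))
    (hS : IsClosed (S : Set (ToeplitzAlgebra.{w} Λ))) (h : ∀ l, Λ.toeplitzFamily l ∈ S) :
    S = ⊤ := by
  have hcl : IsClosed (toeplitzSubalgebra.{w} Λ : Set (TCKProduct.{w} Λ)) :=
    NonUnitalStarSubalgebra.isClosed_topologicalClosure _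
  let ι : ToeplitzAlgebra.{w} Λ →⋆ₙₐ[ℂ] TCKProduct.{w} Λ :=
    NonUnitalStarSubalgebraClass.subtype (toeplitzSubalgebra.{w} Λ)
  have hι : Topology.IsClosedEmbedding ι := hcl.isClosedEmbedding_subtypeVal
  have hle : toeplitzSubalgebra.{w} Λ ≤ S.map ι := by
    refine NonUnitalStarSubalgebra.topologicalClosure_minimal _
      (NonUnitalStarAlgebra.adjoin_le ?_) ?_
    · rintro _ ⟨l, rfl⟩
      exact ⟨_, h l, rfl⟩
    · rw [NonUnitalStarSubalgebra.coe_map]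
      exact hι.isClosedMap _ hS
  refine eq_top_iff.2 fun a _ => ?_
  obtain ⟨b, hb, hba⟩ := hle a.2
  have : b = a := hι.injective hba
  exact this ▸ hb

/-- The universal property of the Toeplitz algebra. -/
theorem toeplitz_universal {B : Type w} [NonUnitalCStarAlgebra B] (T : GPath V → B)
    (hT : Λ.IsTCKFamily T) :
    ∃! π : ToeplitzAlgebra.{w} Λ →⋆ₙₐ[ℂ] B, ∀ l, π (Λ.toeplitzFamily l) = T l := by
  refine ⟨Λ.evalRep ⟨B, T, hT⟩, fun l => rfl, fun π hπ => ?_⟩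
  have hc : ∀ φ : ToeplitzAlgebra.{w} Λ →⋆ₙₐ[ℂ] B, Continuous φ := fun φ =>
    AddMonoidHomClass.continuous_of_bound φ 1 fun a => by
      simpa using NonUnitalStarAlgHom.norm_apply_le φ a
  have := Λ.toeplitz_generated (NonUnitalStarAlgHom.equalizer π (Λ.evalRep ⟨B, T, hT⟩))
    (isClosed_eq (hc _) (hc _)) (fun l => hπ l)
  ext a
  have ha : a ∈ NonUnitalStarAlgHom.equalizer π (Λ.evalRep ⟨B, T, hT⟩) := by
    rw [this]; trivial
  exact ha

/-! ## The gauge action and the dynamics -/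

/-- The family obtained from a family `T` by replacing `T l` by `z ^ deg l • T l`. -/
noncomputable def twist (z : Fin k → Circle) (R : TCKRep.{w} Λ) : TCKRep.{w} Λ :=
  ⟨R.carrier, fun l => torusPow z (Λ.deg l) • R.T l, R.isTCK.gauge z⟩

lemma apply_congr (f : TCKProduct.{w} Λ) (R : TCKRep.{w} Λ) (T : GPath V → R.carrier)
    (hT : Λ.IsTCKFamily T) (h : T = R.T) :
    (f : ∀ R : TCKRep.{w} Λ, R.carrier) ⟨R.carrier, T, hT⟩ =
      (f : ∀ R : TCKRep.{w} Λ, R.carrier) R := by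
  subst h; rfl

/-- The `*`-endomorphism of the product whose coordinate at a family is the coordinate of its
argument at the twisted family. -/
noncomputable def productGauge (z : Fin k → Circle) :
    TCKProduct.{w} Λ →⋆ₙₐ[ℂ] TCKProduct.{w} Λ where
  toFun f := ⟨fun R => (f : ∀ R : TCKRep.{w} Λ, R.carrier) (Λ.twist z R), by
    refine memℓp_infty ⟨‖f‖, ?_⟩
    rintro _ ⟨R, rfl⟩
    exact lp.norm_apply_le_norm ENNReal.top_ne_zero f (Λ.twist z R)⟩
  map_smul' _ _ := rfl
  map_zero' := rfl
  map_add' _ _ := rfl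
  map_mul' _ _ := rfl
  map_star' _ := rfl

lemma productGauge_productFamily (z : Fin k → Circle) (l : GPath V) :
    Λ.productGauge z (Λ.productFamily l : TCKProduct.{w} Λ) =
      torusPow z (Λ.deg l) • Λ.productFamily l := rfl

lemma productGauge_mem (z : Fin k → Circle) {a : TCKProduct.{w} Λ}
    (ha : a ∈ toeplitzSubalgebra.{w} Λ) : Λ.productGauge z a ∈ toeplitzSubalgebra.{w} Λ := by
  have hc : Continuous (Λ.productGauge z : TCKProduct.{w} Λ → TCKProduct.{w} Λ) :=
    AddMonoidHomClass.continuous_of_bound _ 1 fun a => by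
      simpa using NonUnitalStarAlgHom.norm_apply_le (Λ.productGauge z) a
  have hle : toeplitzSubalgebra.{w} Λ ≤ (toeplitzSubalgebra.{w} Λ).comap (Λ.productGauge z) := by
    refine NonUnitalStarSubalgebra.topologicalClosure_minimal _
      (NonUnitalStarAlgebra.adjoin_le ?_)
      ((NonUnitalStarSubalgebra.isClosed_topologicalClosure _).preimage hc)
    rintro _ ⟨l, rfl⟩
    change Λ.productGauge z (Λ.productFamily l) ∈ toeplitzSubalgebra.{w} Λ
    rw [productGauge_productFamily]
    exact SMulMemClass.smul_mem _ (Λ.toeplitzFamily l).2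
  exact hle ha

/-- The underlying map of the gauge automorphism `γ_z`. -/
noncomputable def gaugeFun (z : Fin k → Circle) (a : ToeplitzAlgebra.{w} Λ) :
    ToeplitzAlgebra.{w} Λ :=
  ⟨Λ.productGauge z a.1, Λ.productGauge_mem z a.2⟩

lemma gaugeFun_one (a : ToeplitzAlgebra.{w} Λ) : Λ.gaugeFun 1 a = a := by
  refine Λ.toeplitz_ext fun R => ?_
  exact Λ.apply_congr a.1 R _ _ (by funext l; simp [torusPow])

lemma gaugeFun_mul (y z : Fin k → Circle) (a : ToeplitzAlgebra.{w} Λ) :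
    Λ.gaugeFun (y * z) a = Λ.gaugeFun y (Λ.gaugeFun z a) := by
  refine Λ.toeplitz_ext fun R => ?_
  refine Λ.apply_congr a.1 (Λ.twist z (Λ.twist y R)) _ _ ?_
  funext l
  simp [twist, torusPow, mul_pow, Finset.prod_mul_distrib, smul_smul, mul_comm]

/-- The gauge action of the torus by automorphisms of the Toeplitz algebra. -/
noncomputable def gaugeAction :
    (Fin k → Circle) →* (ToeplitzAlgebra.{w} Λ ≃⋆ₐ[ℂ] ToeplitzAlgebra.{w} Λ) where
  toFun z :=
    { toFun := Λ.gaugeFun z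
      invFun := Λ.gaugeFun z⁻¹
      left_inv := fun a => by rw [← gaugeFun_mul, inv_mul_cancel, gaugeFun_one]
      right_inv := fun a => by rw [← gaugeFun_mul, mul_inv_cancel, gaugeFun_one]
      map_mul' := fun _ _ => rfl
      map_add' := fun _ _ => rfl
      map_star' := fun _ => rfl
      map_smul' := fun _ _ => rfl }
  map_one' := StarAlgEquiv.ext fun a => Λ.gaugeFun_one a
  map_mul' y z := StarAlgEquiv.ext fun a => Λ.gaugeFun_mul y z a

/-- The gauge action is characterised by `γ_z (t_l) = z ^ deg l • t_l`. -/
theorem gaugeAction_toeplitzFamily (z : Fin k → Circle) (l : GPath V) :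
    Λ.gaugeAction z (Λ.toeplitzFamily l : ToeplitzAlgebra.{w} Λ) =
      torusPow z (Λ.deg l) • Λ.toeplitzFamily l := rfl

/-- The dynamics `α^r_t = γ_{(exp (i t r_1), …, exp (i t r_k))}`. -/
noncomputable def dynamics (r : Fin k → ℝ) (t : ℝ) :
    ToeplitzAlgebra.{w} Λ ≃⋆ₐ[ℂ] ToeplitzAlgebra.{w} Λ :=
  Λ.gaugeAction fun i => Circle.exp (t * r i)

end KGraph

/-! ## KMS states -/

section KMS

variable {A : Type*} [NonUnitalCStarAlgebra A]

/-- States of a C*-algebra: positive linear functionals of norm one. -/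
def IsState (ψ : A →L[ℂ] ℂ) : Prop := (∀ a, 0 ≤ ψ (star a * a)) ∧ ‖ψ‖ = 1

/-- `F` is an analytic extension to `ℂ` of the orbit `t ↦ α_t a`. -/
def IsAnalyticExtension (α : ℝ → A ≃⋆ₐ[ℂ] A) (a : A) (F : ℂ → A) : Prop :=
  Differentiable ℂ F ∧ ∀ t : ℝ, F t = α t a

/-- The elements `a` for which `t ↦ α_t a` extends to an analytic function on `ℂ`. -/
def IsAnalyticElement (α : ℝ → A ≃⋆ₐ[ℂ] A) (a : A) : Prop := ∃ F, IsAnalyticExtension α a F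

/-- KMS states with inverse temperature `β`: states such that `ψ (a b) = ψ (b α_{iβ}(a))` for all
analytic elements `a` and `b`, where `α_z(a)` is the analytic extension of `t ↦ α_t a`. -/
def IsKMSState (α : ℝ → A ≃⋆ₐ[ℂ] A) (β : ℝ) (ψ : A →L[ℂ] ℂ) : Prop :=
  IsState ψ ∧ ∀ (a b : A) (F : ℂ → A), IsAnalyticExtension α a F → IsAnalyticElement α b →
    ψ (a * b) = ψ (b * F (Complex.I * β))

end KMS

/-! Put m_v = ψ(q_v) ≥ 0. The projections t_e t_e^* over the edges e of colour j with range v are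
mutually orthogonal and lie under q_v, and the KMS condition gives them the values e^{-r_j}
m_{s(e)}. Positivity of ψ therefore yields A_j m ≤ e^{r_j} m (`kms_vertexMatrix_le`), and e^{r_j} =
ρ(A_{C,j}) by criticality.

Dropping the terms outside C shows that m|_C is subinvariant for the irreducible block A_{C,j} at
its own spectral radius. By Perron–Frobenius theory such a vector is an eigenvector
(`mulVec_eq_spectralRadius_smul`): otherwise a positive matrix commuting with the block makes the
inequality strict in every coordinate, and the Collatz–Wielandt bound then puts all eigenvalues
strictly below the spectral radius. Hence the terms inside C already exhaust the bound, so m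
vanishes at the source of every edge of colour j with range in C and source outside
(`kms_vertexProj_eq_zero_of_edge`).

Zeros of m propagate from the range of a path to its source, and a path of degree n e_j from C to a
vertex outside must contain such an edge. -/

/-! ## Subinvariant vectors of nonnegative matrices -/

namespace Matrix

variable {n : Type*} [Fintype n]

/-- The Collatz-Wielandt bound: a positive vector `x` with `A x ≤ c x` bounds the modulus of all
eigenvalues of the nonnegative matrix `A`. -/
lemma norm_le_of_mem_spectrum_of_mulVec_le [DecidableEq n] {A : Matrix n n ℝ}
    (hA : ∀ i j, 0 ≤ A i j) {x : n → ℝ} (hx : ∀ i, 0 < x i) {c : ℝ}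
    (hc : ∀ i, (A *ᵥ x) i ≤ c * x i) {μ : ℂ} (hμ : μ ∈ spectrum ℂ (A.map ((↑) : ℝ → ℂ))) :
    ‖μ‖ ≤ c := by
  rw [← spectrum_toLin', ← Module.End.hasEigenvalue_iff_mem_spectrum] at hμ
  obtain ⟨v, hv⟩ := hμ.exists_hasEigenvector
  have hv0 : v ≠ 0 := hv.2
  have hev : ∀ i, ∑ j, (A i j : ℂ) * v j = μ * v i := fun i => by
    simpa [mulVec, dotProduct] using congrFun hv.apply_eq_smul i
  obtain ⟨i₀, hi₀⟩ := Function.ne_iff.1 hv0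
  -- M is the norm of v in the sup norm weighted by x; the eigenvalue equation is read at a
  -- coordinate where it is attained.
  obtain ⟨i, -, hi⟩ := Finset.exists_max_image Finset.univ (fun i => ‖v i‖ / x i) ⟨i₀, by simp⟩
  set M := ‖v i‖ / x i with hM
  have hle : ∀ j, ‖v j‖ ≤ M * x j := fun j => (div_le_iff₀ (hx j)).1 (hi j (by simp))
  have hMpos : 0 < M := (div_pos (norm_pos_iff.2 hi₀) (hx i₀)).trans_le (hi i₀ (by simp))
  have hvi : ‖v i‖ = M * x i := by rw [hM, div_mul_cancel₀ _ (hx i).ne']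
  have key : ‖μ‖ * (M * x i) ≤ c * (M * x i) := by
    calc ‖μ‖ * (M * x i) = ‖∑ j, (A i j : ℂ) * v j‖ := by rw [hev, norm_mul, hvi]
      _ ≤ ∑ j, ‖(A i j : ℂ) * v j‖ := norm_sum_le _ _
      _ ≤ ∑ j, M * (A i j * x j) := by
        refine Finset.sum_le_sum fun j _ => ?_
        rw [norm_mul, Complex.norm_real, Real.norm_of_nonneg (hA i j)]
        calc A i j * ‖v j‖ ≤ A i j * (M * x j) := by gcongr; exacts [hA i j, hle j]
          _ = M * (A i j * x j) := by ring
      _ = M * (A *ᵥ x) i := by rw [← Finset.mul_sum]; rfl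
      _ ≤ M * (c * x i) := by gcongr; exact hc i
      _ = c * (M * x i) := by ring
  exact le_of_mul_le_mul_right key (mul_pos hMpos (hx i))

/-- An irreducible matrix commutes with a matrix all of whose entries are positive. -/
lemma IsIrreducible.exists_commute_pos {A : Matrix n n ℝ} (hA : A.IsIrreducible) :
    ∃ S : Matrix n n ℝ, Commute A S ∧ ∀ i j, 0 < S i j := by
  classical
  choose m _ hm using (isIrreducible_iff_exists_pow_pos hA.nonneg).1 hA
  have h0 : ∀ (k : ℕ) i j, 0 ≤ (A ^ k) i j := fun k => by
    induction k with
    | zero => intro i j; rw [pow_zero, one_apply]; split_ifs <;> norm_num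
    | succ k ih =>
      intro i j
      rw [pow_succ, mul_apply]
      exact Finset.sum_nonneg fun l _ => mul_nonneg (ih i l) (hA.nonneg l j)
  -- Some power of A is positive at each given entry; summing one such power per entry makes all
  -- entries positive at once.
  refine ⟨∑ p : n × n, A ^ m p.1 p.2, Commute.sum_right _ _ _ fun p _ => Commute.self_pow A _,
    fun i j => ?_⟩
  rw [sum_apply]
  exact (hm i j).trans_le
    (Finset.single_le_sum (f := fun p : n × n => (A ^ m p.1 p.2) i j)
      (fun p _ => h0 _ i j) (Finset.mem_univ (i, j)))

lemma mulVec_pos_of_pos {S : Matrix n n ℝ} (hS : ∀ i j, 0 < S i j) {y : n → ℝ}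
    (hy : ∀ i, 0 ≤ y i) (hy0 : y ≠ 0) (i : n) : 0 < (S *ᵥ y) i := by
  obtain ⟨j, hj⟩ := Function.ne_iff.1 hy0
  exact Finset.sum_pos' (fun l _ => mul_nonneg (hS i l).le (hy l))
    ⟨j, Finset.mem_univ j, mul_pos (hS i j) ((hy j).lt_of_ne' hj)⟩

/-- A nonnegative subinvariant vector of an irreducible matrix, at a value that no smaller bound
on the eigenvalues improves, is invariant. -/
lemma IsIrreducible.mulVec_eq_of_mulVec_le [DecidableEq n] {A : Matrix n n ℝ}
    (hA : A.IsIrreducible) {c : ℝ}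
    (hc : ∀ b, 0 ≤ b → (∀ μ ∈ spectrum ℂ (A.map ((↑) : ℝ → ℂ)), ‖μ‖ ≤ b) → c ≤ b)
    {x : n → ℝ} (hx : ∀ i, 0 ≤ x i) (hAx : ∀ i, (A *ᵥ x) i ≤ c * x i) : A *ᵥ x = c • x := by
  by_contra hne
  have hx0 : x ≠ 0 := by rintro rfl; simp at hne
  obtain ⟨S, hAS, hS⟩ := hA.exists_commute_pos
  have hpos := mulVec_pos_of_pos hS hx hx0
  -- S turns the nonzero, nonnegative gap c x - A x into a strictly positive vector, which is the
  -- gap of S x because S commutes with A.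
  have hlt : ∀ i, (A *ᵥ (S *ᵥ x)) i < c * (S *ᵥ x) i := fun i => by
    have := mulVec_pos_of_pos hS (y := c • x - A *ᵥ x) (fun i => sub_nonneg.2 (hAx i))
      (sub_ne_zero.2 (Ne.symm hne)) i
    rw [mulVec_sub, mulVec_smul, mulVec_mulVec, ← hAS.eq, ← mulVec_mulVec] at this
    simpa using this
  have : Nonempty n := (Function.ne_iff.1 hx0).nonempty
  obtain ⟨i, -, hi⟩ := Finset.exists_max_image Finset.univ
    (fun i => (A *ᵥ (S *ᵥ x)) i / (S *ᵥ x) i) Finset.univ_nonempty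
  -- The largest ratio for S x bounds every eigenvalue, yet it is strictly below c.
  refine absurd (hc ((A *ᵥ (S *ᵥ x)) i / (S *ᵥ x) i) ?_ fun μ hμ => ?_)
    (not_le.2 ((div_lt_iff₀ (hpos i)).2 (hlt i)))
  · exact div_nonneg (Finset.sum_nonneg fun j _ => mul_nonneg (hA.nonneg i j) (hpos j).le)
      (hpos i).le
  · exact norm_le_of_mem_spectrum_of_mulVec_le hA.nonneg hpos
      (fun j => (div_le_iff₀ (hpos j)).1 (hi j (Finset.mem_univ j))) hμ

end Matrix

/-- A nonnegative vector `x` with `A x ≤ ρ(A) x`, where `A` is irreducible, is an eigenvector. -/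
lemma mulVec_eq_spectralRadius_smul {n : Type*} [Fintype n] {A : Matrix n n ℕ}
    (hA : (A.map (Nat.cast : ℕ → ℝ)).IsIrreducible) {x : n → ℝ}
    (hx : ∀ i, 0 ≤ x i) (hAx : ∀ i, ∑ j, (A i j : ℝ) * x j ≤ matrixSpectralRadius A * x i) (i : n) :
    ∑ j, (A i j : ℝ) * x j = matrixSpectralRadius A * x i := by
  classical
  refine congrFun (hA.mulVec_eq_of_mulVec_le (fun b hb h => ?_) hx hAx) i
  have hmap : (A.map (Nat.cast : ℕ → ℝ)).map ((↑) : ℝ → ℂ) = A.map (Nat.cast : ℕ → ℂ) := by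
    ext i j; simp
  rw [hmap] at h
  refine ENNReal.toReal_le_of_le_ofReal hb ?_
  refine iSup₂_le fun μ hμ => ?_
  rw [ENNReal.le_ofReal_iff_toReal_le ENNReal.coe_ne_top hb]
  refine h μ ?_
  -- The two spectra differ only in the `Fintype` and `DecidableEq` instances behind the matrix
  -- algebra.
  convert hμ
  rfl

/-! ## Paths of a given degree -/

namespace KGraph

variable {k : ℕ} {V : Type u} [Category.{v} V] (Λ : KGraph k V)

lemma isComp_vertexPath_source (l : GPath V) : IsComp l (vertexPath l.source) l := by
  obtain ⟨x, y, f⟩ := l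
  simpa [vertexPath] using IsComp.mk (𝟙 x) f

lemma isComp_vertexPath_range (l : GPath V) : IsComp (vertexPath l.range) l l := by
  obtain ⟨x, y, f⟩ := l
  simpa [vertexPath] using IsComp.mk f (𝟙 y)

/-- Composing with a path of degree zero, which is a vertex, does not change a path. -/
lemma eq_of_isComp_of_deg_eq_zero {l a n : GPath V} (h : IsComp l a n) (ha : Λ.deg a = 0) :
    a = vertexPath l.source ∧ n = l := by
  cases h with
  | @mk x y z g f =>
    have hg : Λ.degree g = 0 := ha
    -- As 0 = 0 + 0, both ways of splitting off an identity from g are factorisations of the same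
    -- type; uniqueness identifies them.
    obtain ⟨p, -, hp⟩ := Λ.factorisation g 0 0 (by simpa using hg)
    have h1 := hp ⟨x, 𝟙 x, g⟩ ⟨hg, Λ.degree_id x, by simp⟩
    have h2 := hp ⟨y, g, 𝟙 y⟩ ⟨Λ.degree_id y, hg, by simp⟩
    have h3 := h1.trans h2.symm
    obtain rfl : x = y := congrArg Sigma.fst h3
    have h4 : (𝟙 x, g) = (g, 𝟙 x) := eq_of_heq (Sigma.mk.inj h3).2
    obtain rfl : 𝟙 x = g := congrArg Prod.fst h4
    exact ⟨rfl, by simp⟩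

/-- A minimal common extension of two paths of equal degree has that same degree, so nothing is
appended. This reduces the relation for t_l^* t_m to orthogonality of range projections. -/
lemma deg_eq_zero_of_minExt {l m : GPath V} (hlm : Λ.deg l = Λ.deg m) {p : GPath V × GPath V}
    {n : GPath V} (h1 : IsComp l p.1 n) (h2 : IsComp m p.2 n) (h3 : Λ.deg n = Λ.deg l ⊔ Λ.deg m) :
    Λ.deg p.1 = 0 ∧ Λ.deg p.2 = 0 := by
  have e1 := Λ.deg_of_isComp h1
  have e2 := Λ.deg_of_isComp h2
  rw [hlm, sup_idem] at h3
  rw [h3] at e1 e2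
  rw [hlm] at e1
  exact ⟨by simpa using e1.symm, by simpa using e2.symm⟩

lemma minExt_self (l : GPath V) :
    Λ.minExt l l = {(vertexPath l.source, vertexPath l.source)} := by
  ext p
  constructor
  · rintro ⟨n, h1, h2, h3⟩
    obtain ⟨d1, d2⟩ := Λ.deg_eq_zero_of_minExt rfl h1 h2 h3
    exact Prod.ext (Λ.eq_of_isComp_of_deg_eq_zero h1 d1).1
      (Λ.eq_of_isComp_of_deg_eq_zero h2 d2).1
  · rintro rfl
    exact ⟨l, isComp_vertexPath_source l, isComp_vertexPath_source l, by simp⟩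

lemma minExt_eq_empty {l m : GPath V} (hlm : Λ.deg l = Λ.deg m) (hne : l ≠ m) :
    Λ.minExt l m = ∅ := by
  rw [Set.eq_empty_iff_forall_notMem]
  rintro p ⟨n, h1, h2, h3⟩
  obtain ⟨d1, d2⟩ := Λ.deg_eq_zero_of_minExt hlm h1 h2 h3
  exact hne ((Λ.eq_of_isComp_of_deg_eq_zero h1 d1).2.symm.trans
    (Λ.eq_of_isComp_of_deg_eq_zero h2 d2).2)

/-! ## Range projections -/

namespace IsTCKFamily

variable {Λ} {B : Type*} [NonUnitalCStarAlgebra B] {T : GPath V → B}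

lemma star_mul_self (h : Λ.IsTCKFamily T) (l : GPath V) :
    star (T l) * T l = T (vertexPath l.source) := by
  have hp := h.projection l.source
  rw [h.adjoint_mul, minExt_self, finsum_mem_singleton, hp.isSelfAdjoint.star_eq,
    hp.isIdempotentElem.eq]

lemma star_mul_of_ne (h : Λ.IsTCKFamily T) {l m : GPath V} (hlm : Λ.deg l = Λ.deg m)
    (hne : l ≠ m) : star (T l) * T m = 0 := by
  rw [h.adjoint_mul, Λ.minExt_eq_empty hlm hne, finsum_mem_empty]

/-- The range projections of distinct paths of one degree and with range `x` are orthogonal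
subprojections of the vertex projection at `x`. -/
lemma isStarProjection_sub_sum (h : Λ.IsTCKFamily T) {ι : Type*} [Fintype ι] {l : ι → GPath V}
    (hl : Function.Injective l) {x : V} (hx : ∀ i, (l i).range = x) {n : Fin k → ℕ}
    (hn : ∀ i, Λ.deg (l i) = n) :
    IsStarProjection (T (vertexPath x) - ∑ i, T (l i) * star (T (l i))) := by
  classical
  set q := T (vertexPath x) with hq
  set P := ∑ i, T (l i) * star (T (l i)) with hP
  have hqp : IsStarProjection q := h.projection x
  have hPs : star P = P := by simp [hP, star_sum]
  have hqP : q * P = P := by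
    rw [hP, Finset.mul_sum]
    refine Finset.sum_congr rfl fun i _ => ?_
    rw [← mul_assoc, hq, ← hx i, h.comp_mul _ _ _ (isComp_vertexPath_range (l i))]
  have hPq : P * q = P := by
    have := congrArg star hqP
    rwa [StarMul.star_mul, hPs, hqp.isSelfAdjoint.star_eq] at this
  -- The cross terms contain t_l^* t_m with l ≠ m of the same degree, hence vanish.
  have hPP : P * P = P := by
    conv_lhs => rw [hP, Finset.sum_mul]
    refine Finset.sum_congr rfl fun i _ => ?_
    rw [Finset.mul_sum, Finset.sum_eq_single i]
    · rw [← mul_assoc, h.partialIsometry]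
    · intro m _ hm
      rw [mul_assoc, ← mul_assoc (star _), h.star_mul_of_ne ((hn i).trans (hn m).symm)
        (hl.ne hm.symm)]
      simp
    · simp
  refine ⟨?_, ?_⟩
  · change (q - P) * (q - P) = q - P
    rw [sub_mul, mul_sub, mul_sub, hqp.isIdempotentElem.eq, hqP, hPq, hPP]
    abel
  · change star (q - P) = q - P
    rw [star_sub, hPs, hqp.isSelfAdjoint.star_eq]

end IsTCKFamily

/-! ## KMS states on range projections -/

lemma dynamics_toeplitzFamily (r : Fin k → ℝ) (t : ℝ) (l : GPath V) :
    Λ.dynamics r t (Λ.toeplitzFamily l : ToeplitzAlgebra.{w} Λ) =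
      Complex.exp (Complex.I * t * ∑ i, (r i * Λ.deg l i : ℝ)) • Λ.toeplitzFamily l := by
  rw [dynamics, gaugeAction_toeplitzFamily]
  congr 1
  simp only [torusPow, Circle.coe_exp, ← Complex.exp_nat_mul, ← Complex.exp_sum]
  congr 1
  push_cast
  rw [Finset.mul_sum]
  exact Finset.sum_congr rfl fun i _ => by ring

lemma isAnalyticExtension_toeplitzFamily (r : Fin k → ℝ) (l : GPath V) :
    IsAnalyticExtension (Λ.dynamics r) (Λ.toeplitzFamily l : ToeplitzAlgebra.{w} Λ)
      fun z => Complex.exp (Complex.I * z * ∑ i, (r i * Λ.deg l i : ℝ)) • Λ.toeplitzFamily l :=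
  ⟨by fun_prop, fun t => (Λ.dynamics_toeplitzFamily r t l).symm⟩

lemma isAnalyticElement_star_toeplitzFamily (r : Fin k → ℝ) (l : GPath V) :
    IsAnalyticElement (Λ.dynamics r) (star (Λ.toeplitzFamily l : ToeplitzAlgebra.{w} Λ)) := by
  refine ⟨fun z => Complex.exp (-(Complex.I * z * ∑ i, (r i * Λ.deg l i : ℝ))) •
    star (Λ.toeplitzFamily l), by fun_prop, fun t => ?_⟩
  rw [map_star, dynamics_toeplitzFamily, star_smul, ← starRingEnd_apply, ← Complex.exp_conj]
  simp

variable {r : Fin k → ℝ} {β : ℝ} {ψ : ToeplitzAlgebra.{w} Λ →L[ℂ] ℂ}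

/-- Take a = t_l and b = t_l^* in the KMS condition: at iβ the orbit of t_l extends to e^{-β r·d(l)}
t_l, and t_l^* t_l is the vertex projection at the source. -/
lemma kms_range_projection (hfin : Λ.IsFinite) (hψ : IsKMSState (Λ.dynamics r) β ψ)
    (l : GPath V) :
    ψ (Λ.toeplitzFamily l * star (Λ.toeplitzFamily l)) =
      (Real.exp (-(β * ∑ i, r i * Λ.deg l i)) : ℝ) * ψ (Λ.vertexProj l.source) := by
  rw [hψ.2 _ _ _ (Λ.isAnalyticExtension_toeplitzFamily r l)
    (Λ.isAnalyticElement_star_toeplitzFamily r l), mul_smul_comm,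
    (Λ.toeplitzFamily_isTCK hfin).star_mul_self, map_smul, smul_eq_mul, vertexProj]
  congr 1
  push_cast
  congr 1
  rw [← mul_assoc Complex.I, Complex.I_mul_I]
  ring

lemma IsState.apply_projection_nonneg {A : Type*} [NonUnitalCStarAlgebra A] {ψ : A →L[ℂ] ℂ}
    (hψ : IsState ψ) {p : A} (hp : IsStarProjection p) : 0 ≤ ψ p := by
  have := hψ.1 p
  rwa [hp.isSelfAdjoint.star_eq, hp.isIdempotentElem.eq] at this

lemma kms_vertexProj_nonneg (hfin : Λ.IsFinite) (hψ : IsKMSState (Λ.dynamics r) β ψ) (x : V) :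
    0 ≤ ψ (Λ.vertexProj x) :=
  IsState.apply_projection_nonneg hψ.1 ((Λ.toeplitzFamily_isTCK hfin).projection x)

/-- Subinvariance of the values of a KMS state at the vertex projections. -/
lemma kms_sum_le (hfin : Λ.IsFinite) (hψ : IsKMSState (Λ.dynamics r) β ψ)
    {ι : Type*} [Fintype ι] {l : ι → GPath V} (hl : Function.Injective l) {x : V}
    (hx : ∀ i, (l i).range = x) {n : Fin k → ℕ} (hn : ∀ i, Λ.deg (l i) = n) :
    ∑ i, (ψ (Λ.vertexProj (l i).source)).re ≤
      Real.exp (β * ∑ i, r i * n i) * (ψ (Λ.vertexProj x)).re := by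
  have h := IsState.apply_projection_nonneg hψ.1
    ((Λ.toeplitzFamily_isTCK hfin).isStarProjection_sub_sum hl hx hn)
  rw [map_sub, map_sum] at h
  simp only [Λ.kms_range_projection hfin hψ, hn] at h
  have h' := (Complex.le_def.1 h).1
  rw [← Finset.mul_sum, Complex.sub_re, Complex.re_ofReal_mul, Complex.re_sum, Complex.zero_re,
    sub_nonneg, Real.exp_neg, inv_mul_le_iff₀ (Real.exp_pos _)] at h'
  exact h'

/-- The values of a KMS state at the vertices are subinvariant for the vertex matrices. -/
lemma kms_vertexMatrix_le [Fintype V] (hfin : Λ.IsFinite)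
    (hψ : IsKMSState (Λ.dynamics r) β ψ) (j : Fin k) (x : V) :
    ∑ y, (Λ.vertexMatrix j x y : ℝ) * (ψ (Λ.vertexProj y)).re ≤
      Real.exp (β * r j) * (ψ (Λ.vertexProj x)).re := by
  -- The edges of colour j with range x, grouped by source, so that the fibre sizes are the entries
  -- of row x of the vertex matrix.
  let ι := (y : V) × {f : y ⟶ x // Λ.degree f = Pi.single j 1}
  let l : ι → GPath V := fun p => ⟨p.1, x, p.2.1⟩
  have hl : Function.Injective l := by
    rintro ⟨y, f, hf⟩ ⟨y', f', hf'⟩ h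
    obtain ⟨rfl, -, h⟩ := GPath.mk.inj h
    obtain rfl := eq_of_heq h
    rfl
  have hf : Finite ι := by
    have := (hfin (Pi.single j 1)).to_subtype
    exact Finite.of_injective
      (fun p => (⟨l p, p.2.2⟩ : {l : GPath V | Λ.deg l = Pi.single j 1}))
      fun p q h => hl (congrArg Subtype.val h)
  have hfy : ∀ y : V, Finite {f : y ⟶ x // Λ.degree f = Pi.single j 1} := fun y =>
    Finite.of_injective (Sigma.mk y : _ → ι) sigma_mk_injective
  have := fun y => Fintype.ofFinite {f : y ⟶ x // Λ.degree f = Pi.single j 1}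
  have key := Λ.kms_sum_le hfin hψ hl (x := x) (fun _ => rfl) (n := Pi.single j 1) fun p => p.2.2
  have hdeg : ∑ i, r i * ((Pi.single j 1 : Fin k → ℕ) i : ℝ) = r j := by
    rw [Finset.sum_eq_single j] <;> simp +contextual
  rw [hdeg, Fintype.sum_sigma] at key
  refine le_of_eq_of_le (Finset.sum_congr rfl fun y _ => ?_) key
  simp [l, vertexMatrix, Nat.card_eq_fintype_card]

/-- A KMS state that vanishes at a vertex vanishes at every vertex connected to it. -/
lemma kms_vertexProj_eq_zero_of_path (hfin : Λ.IsFinite)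
    (hψ : IsKMSState (Λ.dynamics r) β ψ) (l : GPath V)
    (h : (ψ (Λ.vertexProj l.range)).re = 0) : (ψ (Λ.vertexProj l.source)).re = 0 := by
  -- A single path already gives m_{s(l)} ≤ e^{β r·d(l)} m_{r(l)}.
  have key := Λ.kms_sum_le hfin hψ (ι := Unit) (l := fun _ => l) (fun _ _ _ => rfl)
    (fun _ => rfl) (fun _ => rfl)
  rw [h, mul_zero, Fintype.sum_unique] at key
  exact le_antisymm key (Complex.le_def.1 (Λ.kms_vertexProj_nonneg hfin hψ _)).1

end KGraph

/-! ### Vanishing of KMS states outside a critical component -/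

namespace KGraph

variable {k : ℕ} {V : Type u} [Category.{v} V] (Λ : KGraph k V)

variable {r : Fin k → ℝ} {ψ : ToeplitzAlgebra.{w} Λ →L[ℂ] ℂ}

/-- At a critical component the subinvariance relation is an equality within the component, so that
a KMS state vanishes at the sources of the edges that enter the component from outside. -/
lemma kms_vertexProj_eq_zero_of_edge [Finite V] (hfin : Λ.IsFinite) (hr : ∀ i, 0 < r i)
    {j : Fin k} {C : Set V} (hC : Λ.IsCritical r j C) (hψ : IsKMSState (Λ.dynamics r) 1 ψ)
    (l : GPath V) (hl : Λ.deg l = Pi.single j 1) (hrange : l.range ∈ C) (hsource : l.source ∉ C) :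
    (ψ (Λ.vertexProj l.source)).re = 0 := by
  classical
  have := Fintype.ofFinite V
  set m : V → ℝ := fun x => (ψ (Λ.vertexProj x)).re with hm
  have hm0 : ∀ x, 0 ≤ m x := fun x =>
    (Complex.le_def.1 (Λ.kms_vertexProj_nonneg hfin hψ x)).1
  set ρ := matrixSpectralRadius (Λ.blockMatrix C j) with hρ
  -- Since `Real.log 0 = 0`, a zero spectral radius would force r_j = 0.
  have hρ0 : 0 < ρ := by
    refine lt_of_le_of_ne ENNReal.toReal_nonneg fun h => (hr j).ne' ?_
    rw [hC.critical, ← hρ, ← h, Real.log_zero]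
  have hsub : ∀ x, ∑ y, (Λ.vertexMatrix j x y : ℝ) * m y ≤ ρ * m x := fun x => by
    have := Λ.kms_vertexMatrix_le hfin hψ j x
    rwa [one_mul, hC.critical, ← hρ, Real.exp_log hρ0] at this
  have hsplit : ∀ x, ∑ y, (Λ.vertexMatrix j x y : ℝ) * m y =
      ∑ y : C, (Λ.vertexMatrix j x y : ℝ) * m y +
        ∑ y : {y // y ∉ C}, (Λ.vertexMatrix j x y : ℝ) * m y := fun x =>
    (Fintype.sum_subtype_add_sum_subtype (· ∈ C) fun y => (Λ.vertexMatrix j x y : ℝ) * m y).symm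
  have hnn : ∀ x y, 0 ≤ (Λ.vertexMatrix j x y : ℝ) * m y := fun x y =>
    mul_nonneg (Nat.cast_nonneg _) (hm0 y)
  have heq : ∑ y : C, (Λ.vertexMatrix j l.range y : ℝ) * m y = ρ * m l.range :=
    mulVec_eq_spectralRadius_smul hC.irreducible (x := fun y : C => m y) (fun y => hm0 y)
      (fun x => (le_add_of_nonneg_right (Finset.sum_nonneg fun y _ => hnn _ _)).trans
        ((hsplit x).symm.trans_le (hsub x))) ⟨l.range, hrange⟩
  -- Equality inside C leaves a total of at most 0 for the nonnegative terms outside C.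
  have hle : (Λ.vertexMatrix j l.range l.source : ℝ) * m l.source ≤ 0 := by
    have h1 := Finset.single_le_sum
      (f := fun y : {y // y ∉ C} => (Λ.vertexMatrix j l.range y : ℝ) * m y)
      (fun y _ => hnn _ _) (Finset.mem_univ ⟨l.source, hsource⟩)
    have h2 := hsub l.range
    rw [hsplit, heq] at h2
    dsimp only at h1
    linarith
  have hpos : 0 < Λ.vertexMatrix j l.range l.source := by
    -- Finiteness matters: `Nat.card` of an infinite type is 0.
    have : Finite {f : l.source ⟶ l.range // Λ.degree f = Pi.single j 1} := by
      have := (hfin (Pi.single j 1)).to_subtype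
      refine Finite.of_injective (fun f => (⟨⟨l.source, l.range, f.1⟩, f.2⟩ :
        {l : GPath V | Λ.deg l = Pi.single j 1})) fun f g h => Subtype.ext ?_
      exact eq_of_heq (GPath.mk.inj (congrArg Subtype.val h)).2.2
    have : Nonempty {f : l.source ⟶ l.range // Λ.degree f = Pi.single j 1} := ⟨⟨l.hom, hl⟩⟩
    exact Nat.card_pos
  exact le_antisymm (nonpos_of_mul_nonpos_right hle (Nat.cast_pos.2 hpos)) (hm0 _)

/-- Split off the edge at the range end. If its source is still in C, the remaining path is shorter
and induction applies; otherwise the state vanishes at that source and the zero propagates along the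
remaining path. -/
lemma kms_vertexProj_eq_zero_of_colourPath [Finite V] (hfin : Λ.IsFinite) (hr : ∀ i, 0 < r i)
    {j : Fin k} {C : Set V} (hC : Λ.IsCritical r j C) (hψ : IsKMSState (Λ.dynamics r) 1 ψ)
    (n : ℕ) : ∀ l : GPath V, Λ.deg l = n • Pi.single j 1 → l.range ∈ C → l.source ∉ C →
      (ψ (Λ.vertexProj l.source)).re = 0 := by
  induction n with
  | zero =>
    intro l hl hrange hsource
    rw [zero_smul] at hl
    have h := (Λ.eq_of_isComp_of_deg_eq_zero (isComp_vertexPath_range l) hl).1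
    exact absurd ((congrArg GPath.source h).symm ▸ hrange) hsource
  | succ n ih =>
    rintro ⟨y, x, f⟩ hl hrange hsource
    obtain ⟨⟨z, g, e⟩, ⟨he, hg, -⟩, -⟩ := Λ.factorisation f (Pi.single j 1) (n • Pi.single j 1)
      (by rw [← add_comm, ← succ_nsmul]; exact hl)
    by_cases hz : z ∈ C
    · exact ih ⟨y, z, g⟩ hg hz hsource
    · exact Λ.kms_vertexProj_eq_zero_of_path hfin hψ ⟨y, z, g⟩
        (Λ.kms_vertexProj_eq_zero_of_edge hfin hr hC hψ ⟨z, x, e⟩ he hrange hz)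

end KGraph

theorem mainTheorem8 {k : ℕ} {V : Type u} [Category.{v} V] [Finite V] (Λ : KGraph k V)
    (hfin : Λ.IsFinite) (hns : Λ.NoSourcesOrSinks)
    (r : Fin k → ℝ) (hr : ∀ i, 0 < r i) (hnorm : Λ.IsNormalised r)
    (j : Fin k) (C : Set V) (hC : Λ.IsCritical r j C)
    (ψ : KGraph.ToeplitzAlgebra.{w} Λ →L[ℂ] ℂ) (hψ : IsKMSState (Λ.dynamics r) 1 ψ) :
    ∀ y ∈ Λ.colourReach j C \ C, ψ (Λ.vertexProj y) = 0 := by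
  rintro _ ⟨⟨l, hrange, rfl, n, hl⟩, hsource⟩
  have hre := Λ.kms_vertexProj_eq_zero_of_colourPath hfin hr hC hψ n l hl hrange hsource
  -- The order on ℂ makes a nonnegative number real, so the vanishing real part suffices.
  have him := (Complex.le_def.1 (Λ.kms_vertexProj_nonneg hfin hψ l.source)).2
  exact Complex.ext hre him.symm
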